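/- Let $T\ge 0$ and let $X=(X_t)_{t\in[0,T]}$ be a real centered Gaussian process with $X_0=0$ a.s. on a probability space $(\Omega,\mathcal F,P)$. Let $(\mathcal F^X_t)_{t\in[0,T]}$ be the filtration generated by $X$, and let $L^2_X=L^2(\Omega,\mathcal F^X_T,P)$. Let $\mathfrak H_X$ be the Hilbert space obtained by completing the linear span of the indicator functions $\mathbf 1_{(0,t]}$, $t\in[0,T]$, for the (positive semidefinite) inner product determined by $\langle \mathbf 1_{(0,t]},\mathbf 1_{(0,s]}\rangle=E[X_tX_s]$, where elements of norm zero are identified with zero. Let $I$ be the linear isometry from $\mathfrak H_X$ into $L^2_X$ determined by $I(\mathbf 1_{(0,t]})=X_t$ for all $t\in[0,T]$ (the Wiener integral). For $\xi\in L^2_X$ and $h\in\mathfrak H_X$ put $$(S\xi)(h)=E\left[\xi\,\exp\left(I(h)-\tfrac12E[I(h)^2]\right)\right];$$ the function $S\xi$ on $\mathfrak H_X$ determines $\xi$. Assume that $X$ has an indefinite Wiener integral, i.e. that for every $r\in[0,T]$ there is a (necessarily unique) continuous linear operator $\mathbb I_r:\mathfrak H_X\to\mathfrak H_X$ with $\mathbb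 I_r(\mathbf 1_{(0,t]})=\mathbf 1_{(0,t\wedge r]}$ for all $t\in[0,T]$. Let $\mathbb I_r^*$ be its adjoint. For $r\in[0,T]$ let $$D_r=\left\{\xi\in L^2_X:\ \text{there is } \eta\in L^2_X \text{ with } (S\xi)(\mathbb I_r^*h)=(S\eta)(h)\text{ for all }h\in\mathfrak H_X\right\}.$$ For $\xi\in D_r$ the element $\eta$ is unique; it is called the quasi-conditional expectation of $\xi$ and denoted by $\widetilde E[\xi\,|\,\mathcal F^X_r]$. **Theorem.** The following are equivalent: 1. $X$ is a martingale with respect to $(\mathcal F^X_t)_{t\in[0,T]}$; 2. $\|\mathbb I_r\|_{op}=1$ for every $r\in[0,T]$ for which there is an $s\in[0,r]$ such that $X_s$ is not almost surely $0$ (for all other $r$ one has $\mathbb I_r=0$); 3. for every $r\in[0,T]$, $D_r=L^2_X$ and $\widetilde E[\xi\,|\,\mathcal F^X_r]=E[\xi\,|\,\mathcal F^X_r]$ a.s. for every $\xi\in L^2_X$; 4. $D_r=L^2_X$ for every $r\in[0,T]$. -/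

import Mathlib

open MeasureTheory ProbabilityTheory

noncomputable section

/-- A real centered Gaussian process `(X_t)` with time set `[0, T]` and `X_0 = 0` almost surely. -/
structure CenteredGaussianProcess {Ω : Type*} [MeasurableSpace Ω] (μ : Measure Ω) (T : ℝ) where
  /-- The random variables `X_t`. -/
  val : Set.Icc (0 : ℝ) T → Ω → ℝ
  T_nonneg : 0 ≤ T
  measurable_val : ∀ t, Measurable (val t)
  isGaussian : IsGaussianProcess val μ
  centered : ∀ t, ∫ ω, val t ω ∂μ = 0
  val_zero : val ⟨0, Set.left_mem_Icc.mpr T_nonneg⟩ =ᵐ[μ] 0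

/-- The indicator function of the interval `(0, t]`. -/
def indicatorIoc (t : ℝ) : ℝ → ℝ := Set.indicator (Set.Ioc 0 t) 1

/-- The indicator functions of `(0, t]` with `0 < t ≤ T` are linearly independent
(note that `(0, 0]` is empty). -/
theorem linearIndependent_indicatorIoc (T : ℝ) :
    LinearIndependent ℝ (fun t : Set.Ioc (0 : ℝ) T => indicatorIoc (t : ℝ)) := by
  classical
  rw [linearIndependent_iff']
  intro s g hg
  by_contra! hne
  have hs : (s.filter fun t => g t ≠ 0).Nonempty := by
    obtain ⟨i, hi, hgi⟩ := hne
    exact ⟨i, by simp [hi, hgi]⟩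
  obtain ⟨m, hm, hmax⟩ := Finset.exists_max_image _ (fun t : Set.Ioc (0 : ℝ) T => t) hs
  rw [Finset.mem_filter] at hm
  have h := congrFun hg (m : ℝ)
  simp only [Finset.sum_apply, Pi.smul_apply, smul_eq_mul, Pi.zero_apply] at h
  rw [Finset.sum_eq_single m] at h
  · apply hm.2
    have : indicatorIoc (m : ℝ) (m : ℝ) = 1 := by
      simp only [indicatorIoc]
      rw [Set.indicator_of_mem (Set.right_mem_Ioc.mpr m.2.1)]
      rfl
    rwa [this, mul_one] at h
  · intro b hb hbm
    by_cases hgb : g b = 0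
    · simp [hgb]
    · have hle : b ≤ m := hmax b (by simp [hb, hgb])
      have hlt : (b : ℝ) < m := lt_of_le_of_ne hle (fun h => hbm (Subtype.ext h))
      have : indicatorIoc (b : ℝ) (m : ℝ) = 0 := by
        simp only [indicatorIoc]
        exact Set.indicator_of_notMem (fun h => absurd h.2 (not_le.mpr hlt)) _
      rw [this, mul_zero]
  · intro h; exact absurd hm.1 h

namespace CenteredGaussianProcess

variable {Ω : Type*} [MeasurableSpace Ω] {μ : Measure Ω} {T : ℝ}

/-- The end point `T`, as an element of the time set. -/
def endTime (X : CenteredGaussianProcess μ T) : Set.Icc (0 : ℝ) T :=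
  ⟨T, Set.right_mem_Icc.mpr X.T_nonneg⟩

/-- The filtration `(ℱ_t^X)` generated by `X`. -/
def filtration (X : CenteredGaussianProcess μ T) :
    Filtration (Set.Icc (0 : ℝ) T) ‹MeasurableSpace Ω› :=
  Filtration.natural X.val fun t => (X.measurable_val t).stronglyMeasurable

/-- The space `L²_X = L²(Ω, ℱ_T^X, P)`: the classes in `L²(Ω, P)` that have an
`ℱ_T^X`-measurable representative. -/
abbrev L2X (X : CenteredGaussianProcess μ T) : Submodule ℝ (Lp ℝ 2 μ) :=
  lpMeas ℝ ℝ (X.filtration X.endTime) 2 μ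

theorem memLp_val (X : CenteredGaussianProcess μ T) (t : Set.Icc (0 : ℝ) T) :
    MemLp (X.val t) 2 μ :=
  (X.isGaussian.hasGaussianLaw_eval t).memLp_two

/-- `X_t` as an element of `L²(Ω, P)`. -/
def toL2 (X : CenteredGaussianProcess μ T) (t : Set.Icc (0 : ℝ) T) : Lp ℝ 2 μ :=
  (X.memLp_val t).toLp (X.val t)

/-- The covariance function `R(t, s) = E[X_t X_s]`. -/
def cov (X : CenteredGaussianProcess μ T) (t s : Set.Icc (0 : ℝ) T) : ℝ :=
  ∫ ω, X.val t ω * X.val s ω ∂μ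

theorem inner_toL2 (X : CenteredGaussianProcess μ T) (t s : Set.Icc (0 : ℝ) T) :
    inner ℝ (X.toL2 t) (X.toL2 s) = X.cov t s := by
  rw [L2.inner_def, cov]
  refine integral_congr_ae ?_
  filter_upwards [(X.memLp_val t).coeFn_toLp, (X.memLp_val s).coeFn_toLp] with ω h1 h2
  simp only [toL2, h1, h2, RCLike.inner_apply, conj_trivial]
  ring

/-- The linear span of the indicator functions of `(0, t]`, `t ∈ [0, T]`, inside `ℝ → ℝ`. It is a
type synonym, depending on `X`, because its inner product depends on `X`. -/
def StepFun (_X : CenteredGaussianProcess μ T) : Type :=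
  Submodule.span ℝ (Set.range fun t : Set.Ioc (0 : ℝ) T => indicatorIoc (t : ℝ))

instance (X : CenteredGaussianProcess μ T) : AddCommGroup X.StepFun :=
  inferInstanceAs (AddCommGroup
    (Submodule.span ℝ (Set.range fun t : Set.Ioc (0 : ℝ) T => indicatorIoc (t : ℝ))))

instance (X : CenteredGaussianProcess μ T) : Module ℝ X.StepFun :=
  inferInstanceAs (Module ℝ
    (Submodule.span ℝ (Set.range fun t : Set.Ioc (0 : ℝ) T => indicatorIoc (t : ℝ))))

/-- The indicator function of `(0, t]`, `t ∈ [0, T]`, as a step function. -/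
def stepIndicator (X : CenteredGaussianProcess μ T) (t : Set.Icc (0 : ℝ) T) : X.StepFun :=
  ⟨indicatorIoc (t : ℝ), by
    rcases t.2.1.eq_or_lt with h | h
    · have : indicatorIoc (t : ℝ) = 0 := by
        funext x
        simp [indicatorIoc, ← h]
      rw [this]
      exact Submodule.zero_mem _
    · exact Submodule.subset_span ⟨⟨t, h, t.2.2⟩, rfl⟩⟩

/-- The basis of the space of step functions formed by the indicators of `(0, t]`, `0 < t ≤ T`. -/
def stepBasis (X : CenteredGaussianProcess μ T) : Module.Basis (Set.Ioc (0 : ℝ) T) ℝ X.StepFun :=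
  Module.Basis.span (linearIndependent_indicatorIoc T)

/-- The inclusion of `(0, T]` in `[0, T]`. -/
def incl (t : Set.Ioc (0 : ℝ) T) : Set.Icc (0 : ℝ) T := ⟨t, t.2.1.le, t.2.2⟩

theorem stepBasis_apply (X : CenteredGaussianProcess μ T) (t : Set.Ioc (0 : ℝ) T) :
    X.stepBasis t = X.stepIndicator (incl t) :=
  Subtype.ext (congrArg Subtype.val
    (Module.Basis.span_apply (linearIndependent_indicatorIoc T) t))

theorem stepIndicator_zero (X : CenteredGaussianProcess μ T) (t : Set.Icc (0 : ℝ) T)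
    (ht : (t : ℝ) = 0) : X.stepIndicator t = 0 :=
  Subtype.ext (show indicatorIoc (t : ℝ) = 0 by
    funext x
    simp [indicatorIoc, ht])

theorem toL2_zero (X : CenteredGaussianProcess μ T) (t : Set.Icc (0 : ℝ) T)
    (ht : (t : ℝ) = 0) : X.toL2 t = 0 := by
  obtain rfl : t = ⟨0, Set.left_mem_Icc.mpr X.T_nonneg⟩ := Subtype.ext ht
  exact (Lp.eq_zero_iff_ae_eq_zero).2 ((MemLp.coeFn_toLp _).trans X.val_zero)

/-- The bilinear form on step functions with `⟨1_(0,t], 1_(0,s]⟩ = R(t, s)`. -/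
def stepForm (X : CenteredGaussianProcess μ T) : X.StepFun →ₗ[ℝ] X.StepFun →ₗ[ℝ] ℝ :=
  X.stepBasis.constr ℝ fun t => X.stepBasis.constr ℝ fun s => X.cov (incl t) (incl s)

/-- The linear map on step functions that sends `1_(0,t]` to `X_t`. -/
def stepIntegral (X : CenteredGaussianProcess μ T) : X.StepFun →ₗ[ℝ] Lp ℝ 2 μ :=
  X.stepBasis.constr ℝ fun t => X.toL2 (incl t)

theorem stepIntegral_stepIndicator (X : CenteredGaussianProcess μ T) (t : Set.Icc (0 : ℝ) T) :
    X.stepIntegral (X.stepIndicator t) = X.toL2 t := by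
  rcases t.2.1.eq_or_lt with h | h
  · rw [X.stepIndicator_zero t h.symm, X.toL2_zero t h.symm, map_zero]
  · have h1 : X.stepIndicator t = X.stepBasis ⟨t, h, t.2.2⟩ :=
      (X.stepBasis_apply ⟨t, h, t.2.2⟩).symm
    rw [h1, stepIntegral, Module.Basis.constr_basis]
    rfl

theorem stepForm_eq (X : CenteredGaussianProcess μ T) (f g : X.StepFun) :
    X.stepForm f g = inner ℝ (X.stepIntegral f) (X.stepIntegral g) := by
  have h : X.stepForm = (innerₗ (Lp ℝ 2 μ)).compl₁₂ X.stepIntegral X.stepIntegral := by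
    refine X.stepBasis.ext fun t => X.stepBasis.ext fun s => ?_
    simp [stepForm, stepIntegral, Module.Basis.constr_basis, inner_toL2]
  rw [h]
  rfl

/-- The positive semidefinite inner product `⟨1_(0,t], 1_(0,s]⟩ = R(t, s)` on step functions. -/
@[reducible] def stepCore (X : CenteredGaussianProcess μ T) : PreInnerProductSpace.Core ℝ X.StepFun where
  inner f g := X.stepForm f g
  conj_inner_symm f g := by
    simp only [stepForm_eq, conj_trivial]
    exact real_inner_comm _ _
  re_inner_nonneg f := by
    simp only [stepForm_eq, RCLike.re_to_real]
    exact real_inner_self_nonneg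
  add_left f g h := by simp
  smul_left f g r := by simp

instance (X : CenteredGaussianProcess μ T) : SeminormedAddCommGroup X.StepFun :=
  @InnerProductSpace.Core.toSeminormedAddCommGroup ℝ X.StepFun _ _ _ X.stepCore

instance (X : CenteredGaussianProcess μ T) : InnerProductSpace ℝ X.StepFun :=
  InnerProductSpace.ofCore X.stepCore

theorem inner_step (X : CenteredGaussianProcess μ T) (f g : X.StepFun) :
    inner ℝ f g = X.stepForm f g := rfl

/-- The space `𝓗_X` of deterministic integrands: the Hilbert space obtained by completing the
linear span of the indicators of `(0, t]` (elements of norm zero being identified with zero). -/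
abbrev Integrands (X : CenteredGaussianProcess μ T) : Type :=
  UniformSpace.Completion X.StepFun

/-- The indicator of `(0, t]` as an element of `𝓗_X`. -/
def ind (X : CenteredGaussianProcess μ T) (t : Set.Icc (0 : ℝ) T) : X.Integrands :=
  (X.stepIndicator t : UniformSpace.Completion X.StepFun)

/-- The defining property of the inner product of `𝓗_X`. -/
theorem inner_ind (X : CenteredGaussianProcess μ T) (t s : Set.Icc (0 : ℝ) T) :
    inner ℝ (X.ind t) (X.ind s) = X.cov t s := by
  rw [ind, ind, UniformSpace.Completion.inner_coe, inner_step, stepForm_eq,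
    stepIntegral_stepIndicator, stepIntegral_stepIndicator, inner_toL2]

theorem norm_stepIntegral (X : CenteredGaussianProcess μ T) (f : X.StepFun) :
    ‖X.stepIntegral f‖ = ‖f‖ := by
  rw [@norm_eq_sqrt_real_inner _ _ _ (X.stepIntegral f), ← stepForm_eq, ← inner_step,
    ← norm_eq_sqrt_real_inner]

/-- The Wiener integral `I` of deterministic integrands, with values in `L²(Ω, P)`: the continuous
linear extension to `𝓗_X` of `1_(0,t] ↦ X_t`. -/
def wienerIntegral (X : CenteredGaussianProcess μ T) : X.Integrands →L[ℝ] Lp ℝ 2 μ :=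
  ContinuousLinearMap.extend
    (X.stepIntegral.mkContinuous 1 fun f => by rw [norm_stepIntegral, one_mul])
    (UniformSpace.Completion.toComplL : X.StepFun →L[ℝ] X.Integrands)

theorem wienerIntegral_coe (X : CenteredGaussianProcess μ T) (f : X.StepFun) :
    X.wienerIntegral (f : UniformSpace.Completion X.StepFun) = X.stepIntegral f :=
  ContinuousLinearMap.extend_eq _ UniformSpace.Completion.denseRange_coe
    (UniformSpace.Completion.isUniformInducing_coe _) f

theorem wienerIntegral_ind (X : CenteredGaussianProcess μ T) (t : Set.Icc (0 : ℝ) T) :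
    X.wienerIntegral (X.ind t) = X.toL2 t := by
  rw [ind, wienerIntegral_coe, stepIntegral_stepIndicator]

theorem norm_wienerIntegral (X : CenteredGaussianProcess μ T) (h : X.Integrands) :
    ‖X.wienerIntegral h‖ = ‖h‖ := by
  induction h using UniformSpace.Completion.induction_on with
  | hp => exact isClosed_eq (by fun_prop) (by fun_prop)
  | ih f => rw [wienerIntegral_coe, norm_stepIntegral, UniformSpace.Completion.norm_coe]

/-- `X` has an indefinite Wiener integral: for every `r ∈ [0, T]` there is a continuous linear
operator on `𝓗_X` that sends `1_(0,t]` to `1_(0,t ∧ r]` for every `t ∈ [0, T]`. -/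
def HasIndefiniteWienerIntegral (X : CenteredGaussianProcess μ T) : Prop :=
  ∀ r : Set.Icc (0 : ℝ) T, ∃ A : X.Integrands →L[ℝ] X.Integrands,
    ∀ t : Set.Icc (0 : ℝ) T, A (X.ind t) = X.ind (min t r)

/-- The operator `𝕀_r` on `𝓗_X`. -/
def truncation (X : CenteredGaussianProcess μ T) (hX : X.HasIndefiniteWienerIntegral)
    (r : Set.Icc (0 : ℝ) T) : X.Integrands →L[ℝ] X.Integrands :=
  (hX r).choose

theorem truncation_ind (X : CenteredGaussianProcess μ T) (hX : X.HasIndefiniteWienerIntegral)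
    (r t : Set.Icc (0 : ℝ) T) : X.truncation hX r (X.ind t) = X.ind (min t r) :=
  (hX r).choose_spec t

/-- The operator `𝕀_r` is determined by its values on the indicators. -/
theorem truncation_unique (X : CenteredGaussianProcess μ T) (hX : X.HasIndefiniteWienerIntegral)
    (r : Set.Icc (0 : ℝ) T) (A : X.Integrands →L[ℝ] X.Integrands)
    (hA : ∀ t, A (X.ind t) = X.ind (min t r)) : A = X.truncation hX r := by
  have h : A.comp UniformSpace.Completion.toComplL
      = (X.truncation hX r).comp UniformSpace.Completion.toComplL := by
    refine ContinuousLinearMap.coe_injective (X.stepBasis.ext fun t => ?_)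
    rw [stepBasis_apply]
    exact (hA _).trans (X.truncation_ind hX r _).symm
  refine ContinuousLinearMap.ext fun x => ?_
  induction x using UniformSpace.Completion.induction_on with
  | hp => exact isClosed_eq A.continuous (X.truncation hX r).continuous
  | ih f => exact congrArg (fun B => B f) h

/-- The Wick exponential `exp(I(h) - E[I(h)²] / 2)` of the Wiener integral `I(h)`. -/
def wickExp (X : CenteredGaussianProcess μ T) (h : X.Integrands) (ω : Ω) : ℝ :=
  Real.exp (X.wienerIntegral h ω - (∫ ω', X.wienerIntegral h ω' ^ 2 ∂μ) / 2)

/-- The `S`-transform `(S ξ)(h) = E[ξ exp(I(h) - E[I(h)²] / 2)]`. -/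
def sTransform (X : CenteredGaussianProcess μ T) (ξ : X.L2X) (h : X.Integrands) : ℝ :=
  ∫ ω, (ξ : Lp ℝ 2 μ) ω * X.wickExp h ω ∂μ

/-- The relation between `ξ` and its quasi-conditional expectation `η` given `ℱ_r^X`:
`(S ξ)(𝕀_r^* h) = (S η)(h)` for all `h ∈ 𝓗_X`. -/
def IsQuasiCondExp (X : CenteredGaussianProcess μ T) (hX : X.HasIndefiniteWienerIntegral)
    (r : Set.Icc (0 : ℝ) T) (ξ η : X.L2X) : Prop :=
  ∀ h : X.Integrands,
    X.sTransform ξ (ContinuousLinearMap.adjoint (X.truncation hX r) h) = X.sTransform η h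

/-- The domain `D_r ⊆ L²_X` of the quasi-conditional expectation given `ℱ_r^X`. -/
def quasiDomain (X : CenteredGaussianProcess μ T) (hX : X.HasIndefiniteWienerIntegral)
    (r : Set.Icc (0 : ℝ) T) : Set X.L2X :=
  {ξ | ∃ η : X.L2X, X.IsQuasiCondExp hX r ξ η}

/-- The quasi-conditional expectation of `ξ ∈ D_r` given `ℱ_r^X`: the element `η` of `L²_X` with
`(S ξ)(𝕀_r^* h) = (S η)(h)` for all `h` (the `S`-transform determines `η`). -/
def quasiCondExp (X : CenteredGaussianProcess μ T) (hX : X.HasIndefiniteWienerIntegral)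
    (r : Set.Icc (0 : ℝ) T) (ξ : X.quasiDomain hX r) : X.L2X :=
  ξ.2.choose

end CenteredGaussianProcess

end

/-! All four conditions are equivalent to `UncorrelatedIncrements`: $E[X_tX_s]=E[X_rX_s]$ for $s\le
r\le t$. A martingale has this property by pulling $X_s$ out of the conditional expectation;
conversely, for Gaussian variables uncorrelated means independent (`UncorrelatedIncrements.indep`).

The operator $\mathbb I_r$ is idempotent. The covariance condition makes it self-adjoint, hence an
orthogonal projection and a contraction; conversely a contractive idempotent has orthogonal range
and kernel, which is the covariance condition.

The quasi-conditional expectation enters through Wick exponentials, on which it always acts by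
$g\mapsto\mathbb I_r g$ (`isQuasiCondExp_wickL2`). Under the covariance condition the ordinary
conditional expectation acts in the same way (`UncorrelatedIncrements.condExp_wickExp`), and the two
agree on all of $L^2_X$. If $D_r=L^2_X$, the closed graph theorem bounds the quasi-conditional
expectation; as a Wick exponential has squared norm $e^{\|g\|^2}$, scaling $g$ forces $\|\mathbb
I_r\|\le 1$. Uniqueness rests on `eq_zero_of_sTransform_eq_zero`. -/

noncomputable section

/-! ### The Wiener integral as a Gaussian process. -/

namespace CenteredGaussianProcess

variable {Ω : Type*} [MeasurableSpace Ω] {μ : Measure Ω} {T : ℝ}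

theorem inner_wienerIntegral (X : CenteredGaussianProcess μ T) (g h : X.Integrands) :
    inner ℝ (X.wienerIntegral g) (X.wienerIntegral h) = inner ℝ g h :=
  LinearIsometry.inner_map_map
    (⟨X.wienerIntegral.toLinearMap, X.norm_wienerIntegral⟩ : X.Integrands →ₗᵢ[ℝ] Lp ℝ 2 μ) g h

theorem integral_wienerIntegral_sq (X : CenteredGaussianProcess μ T) (h : X.Integrands) :
    ∫ ω, X.wienerIntegral h ω ^ 2 ∂μ = ‖h‖ ^ 2 := by
  rw [← real_inner_self_eq_norm_sq, ← X.inner_wienerIntegral h h, L2.inner_def]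
  refine integral_congr_ae (.of_forall fun ω => ?_)
  simp [sq]

theorem closure_induction_integrands (X : CenteredGaussianProcess μ T) (K : Submodule ℝ X.Integrands)
    (hK : IsClosed (K : Set X.Integrands)) (hind : ∀ t, X.ind t ∈ K) (h : X.Integrands) : h ∈ K := by
  induction h using UniformSpace.Completion.induction_on with
  | hp => exact hK
  | ih f =>
    have : (⊤ : Submodule ℝ X.StepFun)
        ≤ K.comap (UniformSpace.Completion.toComplL : X.StepFun →L[ℝ] X.Integrands).toLinearMap := by
      rw [← X.stepBasis.span_eq, Submodule.span_le]
      rintro _ ⟨t, rfl⟩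
      rw [stepBasis_apply]
      exact hind _
    exact this Submodule.mem_top

theorem ext_ind (X : CenteredGaussianProcess μ T) {E : Type*} [NormedAddCommGroup E]
    [NormedSpace ℝ E] {A B : X.Integrands →L[ℝ] E} (hAB : ∀ t, A (X.ind t) = B (X.ind t)) :
    A = B := by
  ext h
  have := X.closure_induction_integrands (LinearMap.eqLocus A.toLinearMap B.toLinearMap)
    (isClosed_eq A.continuous B.continuous) hAB h
  exact this

theorem hasGaussianLaw_stepIntegral (X : CenteredGaussianProcess μ T) (f : X.StepFun) :
    HasGaussianLaw (X.stepIntegral f) μ := by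
  have h : HasGaussianLaw (∑ t ∈ (X.stepBasis.repr f).support,
      X.stepBasis.repr f t • X.val (incl t)) μ :=
    ((X.isGaussian.comp_right incl).smul (X.stepBasis.repr f)).hasGaussianLaw_sum
  refine h.congr ?_
  rw [stepIntegral, Module.Basis.constr_apply, Finsupp.sum]
  refine ((Lp.coeFn_finsetSum _ _).trans (eventuallyEq_sum fun t _ => ?_)).symm
  filter_upwards [Lp.coeFn_smul (X.stepBasis.repr f t) (X.toL2 (incl t)),
    (X.memLp_val (incl t)).coeFn_toLp] with ω h1 h2
  rw [h1, Pi.smul_apply, toL2, h2, Pi.smul_apply]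

theorem sum_smul_wienerIntegral (X : CenteredGaussianProcess μ T) {ι : Type*} (I : Finset ι)
    (c : ι → ℝ) (h : ι → X.Integrands) :
    X.wienerIntegral (∑ i ∈ I, c i • h i) =ᵐ[μ] fun ω => ∑ i ∈ I, c i * X.wienerIntegral (h i) ω := by
  rw [map_sum]
  refine (Lp.coeFn_finsetSum _ _).trans ?_
  have : (fun ω => ∑ i ∈ I, c i * X.wienerIntegral (h i) ω)
      = ∑ i ∈ I, fun ω => c i * X.wienerIntegral (h i) ω := by ext; simp
  rw [this]
  refine eventuallyEq_sum fun i _ => ?_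
  rw [map_smul]
  exact Lp.coeFn_smul _ _

variable [IsProbabilityMeasure μ]

theorem integral_eq_inner_one (f : Lp ℝ 2 μ) :
    ∫ ω, f ω ∂μ = inner ℝ (Lp.const 2 μ (1 : ℝ)) f := by
  rw [L2.inner_def]
  exact integral_congr_ae (.of_forall fun ω => by simp)

theorem integral_abs_le_norm (f : Lp ℝ 2 μ) : ∫ ω, |f ω| ∂μ ≤ ‖f‖ := by
  have h1 : ∫ ω, |f ω| ∂μ = ∫ ω, |f| ω ∂μ :=
    integral_congr_ae ((Lp.coeFn_abs f).mono fun ω h => h.symm)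
  rw [h1, integral_eq_inner_one, ← norm_abs_eq_norm f]
  refine (real_inner_le_norm _ _).trans ?_
  have : ‖Lp.const 2 μ (1 : ℝ)‖ ≤ 1 := by
    simpa using Lp.norm_const_le (p := 2) (μ := μ) (1 : ℝ)
  nlinarith [norm_nonneg |f|]

theorem integral_wienerIntegral (X : CenteredGaussianProcess μ T) (h : X.Integrands) :
    ∫ ω, X.wienerIntegral h ω ∂μ = 0 := by
  have : (innerSL ℝ (Lp.const 2 μ (1 : ℝ))).comp X.wienerIntegral = 0 := by
    refine X.ext_ind fun t => ?_
    simp only [ContinuousLinearMap.comp_apply, wienerIntegral_ind, innerSL_apply_apply,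
      ← integral_eq_inner_one, zero_apply]
    rw [← X.centered t]
    exact integral_congr_ae (X.memLp_val t).coeFn_toLp
  rw [integral_eq_inner_one]
  exact congrArg (fun A => A h) this

/-- The map $x\mapsto e^{isx}$ is $|s|$-Lipschitz, and the $L^1$ norm is at most the $L^2$ norm
under a probability measure. The resulting continuity carries Gaussian laws over to $L^2$ limits. -/
theorem lipschitz_charFun (s : ℝ) :
    LipschitzWith (Real.nnabs s) fun f : Lp ℝ 2 μ => charFun (μ.map f) s := by
  have key (f : Lp ℝ 2 μ) : charFun (μ.map f) s = ∫ ω, Complex.exp (s * f ω * Complex.I) ∂μ := by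
    rw [charFun_apply_real, integral_map (Lp.aestronglyMeasurable f).aemeasurable (by fun_prop)]
  have hint (f : Lp ℝ 2 μ) : Integrable (fun ω => Complex.exp (s * f ω * Complex.I)) μ := by
    have hf := Lp.stronglyMeasurable f
    refine Integrable.of_bound (C := 1) (by fun_prop) (.of_forall fun ω => ?_)
    rw [← Complex.ofReal_mul, Complex.norm_exp_ofReal_mul_I]
  refine LipschitzWith.of_dist_le_mul fun f g => ?_
  rw [dist_eq_norm, dist_eq_norm, key, key, ← integral_sub (hint f) (hint g)]
  calc _ ≤ ∫ ω, ‖Complex.exp (s * f ω * Complex.I) - Complex.exp (s * g ω * Complex.I)‖ ∂μ :=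
        norm_integral_le_integral_norm _
    _ ≤ ∫ ω, |s| * |(f - g) ω| ∂μ := by
        refine integral_mono_ae ((hint f).sub (hint g)).norm
          (((Lp.memLp (f - g)).integrable (by norm_num)).abs.const_mul _) ?_
        filter_upwards [Lp.coeFn_sub f g] with ω h
        rw [h, ← abs_mul, Pi.sub_apply, mul_sub]
        have := Real.norm_exp_I_mul_ofReal_sub_one_le (x := s * f ω - s * g ω)
        rw [← Real.norm_eq_abs]
        refine le_trans (le_of_eq ?_) this
        -- Factor out a number of modulus one: $|e^{ia}-e^{ib}|=|e^{ib}|\,|e^{i(a-b)}-1|$.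
        rw [← one_mul ‖Complex.exp (Complex.I * _) - 1‖,
          ← Complex.norm_exp_ofReal_mul_I (s * g ω), ← norm_mul, mul_sub, ← Complex.exp_add]
        congr 2 <;> push_cast <;> ring_nf
    _ = |s| * ∫ ω, |(f - g) ω| ∂μ := integral_const_mul _ _
    _ ≤ _ := by
        rw [Real.coe_nnabs]
        exact mul_le_mul_of_nonneg_left (integral_abs_le_norm _) (abs_nonneg _)

/-- Both sides are continuous in $h$, and for a step function the integral is a finite combination
of the $X_t$, hence Gaussian. -/
theorem charFun_wienerIntegral (X : CenteredGaussianProcess μ T) (h : X.Integrands) (s : ℝ) :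
    charFun (μ.map (X.wienerIntegral h)) s = Complex.exp (-(‖h‖ ^ 2 * s ^ 2 / 2 : ℝ)) := by
  induction h using UniformSpace.Completion.induction_on with
  | hp =>
    exact isClosed_eq ((lipschitz_charFun s).continuous.comp X.wienerIntegral.continuous)
      (by fun_prop)
  | ih f =>
    have hg : HasGaussianLaw (X.wienerIntegral f) μ := by
      rw [wienerIntegral_coe]; exact X.hasGaussianLaw_stepIntegral f
    rw [hg.map_eq_gaussianReal, charFun_gaussianReal, integral_wienerIntegral,
      variance_eq_sub hg.memLp_two, integral_wienerIntegral]
    have := X.integral_wienerIntegral_sq f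
    simp only [Pi.pow_apply]
    rw [this]
    rw [Real.coe_toNNReal _ (by rw [zero_pow two_ne_zero, sub_zero]; exact sq_nonneg _)]
    congr 1
    push_cast
    ring

theorem map_wienerIntegral (X : CenteredGaussianProcess μ T) (h : X.Integrands) :
    μ.map (X.wienerIntegral h) = gaussianReal 0 (‖h‖₊ ^ 2) := by
  have hm := (Lp.aestronglyMeasurable (X.wienerIntegral h)).aemeasurable
  have := Measure.isProbabilityMeasure_map hm
  refine Measure.ext_of_charFun (funext fun s => ?_)
  rw [charFun_wienerIntegral, charFun_gaussianReal]
  congr 1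
  push_cast
  ring

/-- The Wiener integrals form a Gaussian process indexed by the space of integrands. -/
theorem isGaussianProcess_wienerIntegral (X : CenteredGaussianProcess μ T) :
    IsGaussianProcess (fun h : X.Integrands => (X.wienerIntegral h : Ω → ℝ)) μ where
  hasGaussianLaw I := by
    classical
    have hm (h : X.Integrands) : Measurable (X.wienerIntegral h) :=
      (Lp.stronglyMeasurable (X.wienerIntegral h)).measurable
    have hm' : Measurable fun ω => I.restrict fun h => X.wienerIntegral h ω :=
      measurable_pi_lambda _ fun h => hm h
    refine ⟨⟨fun L => ?_⟩⟩
    have hL : HasGaussianLaw (L ∘ fun ω => I.restrict fun h => X.wienerIntegral h ω) μ := by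
      -- By linearity, a functional of finitely many Wiener integrals is a single Wiener integral,
      -- so the one-dimensional laws suffice.
      have h1 : HasGaussianLaw
          (X.wienerIntegral (∑ i : I, L (Pi.single i 1) • (i : X.Integrands))) μ :=
        ⟨by rw [map_wienerIntegral]; infer_instance⟩
      refine h1.congr ?_
      filter_upwards [X.sum_smul_wienerIntegral Finset.univ (fun i : I => L (Pi.single i 1))
        (fun i => i)] with ω hω
      rw [hω, Function.comp_apply]
      conv_rhs => rw [pi_eq_sum_univ' (I.restrict fun h => X.wienerIntegral h ω)]
      rw [map_sum]
      refine Finset.sum_congr rfl fun i _ => ?_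
      rw [map_smul, smul_eq_mul, mul_comm]
      congr 2
    rw [Measure.map_map (by fun_prop) hm', hL.map_eq_gaussianReal,
      integral_map hm'.aemeasurable (by fun_prop), variance_map (by fun_prop) hm'.aemeasurable]
    rfl

end CenteredGaussianProcess

/-! ### Wick exponentials and their $S$-transforms. -/

namespace CenteredGaussianProcess

variable {Ω : Type*} [MeasurableSpace Ω] {μ : Measure Ω} {T : ℝ}

theorem wickExp_eq (X : CenteredGaussianProcess μ T) (h : X.Integrands) (ω : Ω) :
    X.wickExp h ω = Real.exp (X.wienerIntegral h ω - ‖h‖ ^ 2 / 2) := by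
  rw [wickExp, integral_wienerIntegral_sq]

theorem stronglyMeasurable_wickExp (X : CenteredGaussianProcess μ T) (h : X.Integrands) :
    StronglyMeasurable (X.wickExp h) := by
  have := Lp.stronglyMeasurable (X.wienerIntegral h)
  exact Real.continuous_exp.comp_stronglyMeasurable (this.sub stronglyMeasurable_const)

instance (X : CenteredGaussianProcess μ T) (t : Set.Icc (0 : ℝ) T) :
    Fact (X.filtration t ≤ ‹MeasurableSpace Ω›) := ⟨X.filtration.le t⟩

theorem wienerIntegral_mem_L2X (X : CenteredGaussianProcess μ T) (h : X.Integrands) :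
    X.wienerIntegral h ∈ X.L2X := by
  refine X.closure_induction_integrands (X.L2X.comap X.wienerIntegral.toLinearMap) ?_ ?_ h
  · have hc : IsClosed (X.L2X : Set (Lp ℝ 2 μ)) :=
      (completeSpace_coe_iff_isComplete.1
        (inferInstanceAs (CompleteSpace X.L2X))).isClosed
    exact hc.preimage X.wienerIntegral.continuous
  · intro t
    rw [Submodule.mem_comap]
    change X.wienerIntegral (X.ind t) ∈ _
    rw [wienerIntegral_ind, mem_lpMeas_iff_aestronglyMeasurable]
    refine ⟨X.val t, ?_, (X.memLp_val t).coeFn_toLp⟩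
    exact ((Filtration.stronglyAdapted_natural
      fun t => (X.measurable_val t).stronglyMeasurable) t).mono (X.filtration.mono t.2.2)

theorem aestronglyMeasurable_wickExp (X : CenteredGaussianProcess μ T) (h : X.Integrands) :
    AEStronglyMeasurable[X.filtration X.endTime] (X.wickExp h) μ := by
  have := mem_lpMeas_iff_aestronglyMeasurable.1 (X.wienerIntegral_mem_L2X h)
  exact Real.continuous_exp.comp_aestronglyMeasurable (this.sub aestronglyMeasurable_const)

theorem coeFn_wienerIntegral_ind (X : CenteredGaussianProcess μ T) (t : Set.Icc (0 : ℝ) T) :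
    X.wienerIntegral (X.ind t) =ᵐ[μ] X.val t := by
  rw [wienerIntegral_ind]
  exact (X.memLp_val t).coeFn_toLp

/-- This turns exponential moments of finitely many $X_t$ into values of the $S$-transform. -/
theorem dual_val_eq_wienerIntegral (X : CenteredGaussianProcess μ T)
    (J : Finset (Set.Icc (0 : ℝ) T)) (L : StrongDual ℝ (J → ℝ)) :
    ∃ h : X.Integrands, (fun ω => L fun j : J => X.val j ω) =ᵐ[μ] X.wienerIntegral h := by
  classical
  refine ⟨∑ j : J, L (Pi.single j 1) • X.ind j, ?_⟩
  have hall : ∀ᵐ ω ∂μ, ∀ j : J, X.wienerIntegral (X.ind j) ω = X.val j ω :=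
    ae_all_iff.2 fun j => X.coeFn_wienerIntegral_ind j
  filter_upwards [hall, X.sum_smul_wienerIntegral Finset.univ (fun j : J => L (Pi.single j 1))
    (fun j => X.ind j)] with ω h1 h2
  rw [h2, pi_eq_sum_univ' (fun j : J => X.val j ω), map_sum]
  refine Finset.sum_congr rfl fun j _ => ?_
  rw [map_smul, smul_eq_mul, mul_comm, h1]

variable [IsProbabilityMeasure μ]

theorem integrable_exp_wienerIntegral (X : CenteredGaussianProcess μ T) (h : X.Integrands) (u : ℝ) :
    Integrable (fun ω => Real.exp (u * X.wienerIntegral h ω)) μ := by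
  have := integrable_exp_mul_gaussianReal (μ := 0) (v := ‖h‖₊ ^ 2) u
  rw [← X.map_wienerIntegral h] at this
  exact this.comp_aemeasurable (Lp.aestronglyMeasurable _).aemeasurable

theorem integral_exp_wienerIntegral (X : CenteredGaussianProcess μ T) (h : X.Integrands) :
    ∫ ω, Real.exp (X.wienerIntegral h ω) ∂μ = Real.exp (‖h‖ ^ 2 / 2) := by
  have := mgf_gaussianReal (X.map_wienerIntegral h) 1
  simpa [mgf] using this

theorem memLp_wickExp (X : CenteredGaussianProcess μ T) (h : X.Integrands) :
    MemLp (X.wickExp h) 2 μ := by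
  rw [memLp_two_iff_integrable_sq (X.stronglyMeasurable_wickExp h).aestronglyMeasurable]
  refine ((X.integrable_exp_wienerIntegral h 2).mul_const (Real.exp (-‖h‖ ^ 2))).congr
    (.of_forall fun ω => ?_)
  simp only [wickExp_eq]
  rw [← Real.exp_add, ← Real.exp_nat_mul]
  congr 1
  push_cast
  ring

/-- The Wick exponential as an element of `L²_X`. -/
def wickL2 (X : CenteredGaussianProcess μ T) (h : X.Integrands) : X.L2X :=
  ⟨(X.memLp_wickExp h).toLp (X.wickExp h), mem_lpMeas_iff_aestronglyMeasurable.2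
    ((X.aestronglyMeasurable_wickExp h).congr (X.memLp_wickExp h).coeFn_toLp.symm)⟩

theorem coeFn_wickL2 (X : CenteredGaussianProcess μ T) (h : X.Integrands) :
    (X.wickL2 h : Lp ℝ 2 μ) =ᵐ[μ] X.wickExp h := (X.memLp_wickExp h).coeFn_toLp

theorem sTransform_eq_inner (X : CenteredGaussianProcess μ T) (ξ : X.L2X) (h : X.Integrands) :
    X.sTransform ξ h = inner ℝ (X.wickL2 h) ξ := by
  rw [Submodule.coe_inner, L2.inner_def, sTransform]
  refine integral_congr_ae ?_
  filter_upwards [X.coeFn_wickL2 h] with ω hω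
  simp [hω]

/-- Since $E[e^{I(g+h)}]=e^{\|g+h\|^2/2}$, the two normalising factors leave only the cross term. -/
theorem sTransform_wickL2 (X : CenteredGaussianProcess μ T) (g h : X.Integrands) :
    X.sTransform (X.wickL2 g) h = Real.exp (inner ℝ g h) := by
  have h1 : X.sTransform (X.wickL2 g) h = ∫ ω, Real.exp (X.wienerIntegral (g + h) ω)
      * Real.exp (-(‖g‖ ^ 2 + ‖h‖ ^ 2) / 2) ∂μ := by
    refine integral_congr_ae ?_
    filter_upwards [X.coeFn_wickL2 g, Lp.coeFn_add (X.wienerIntegral g) (X.wienerIntegral h)]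
      with ω h1 h2
    rw [h1, wickExp_eq, wickExp_eq, map_add, h2, ← Real.exp_add, ← Real.exp_add, Pi.add_apply]
    congr 1
    ring
  rw [h1, integral_mul_const, integral_exp_wienerIntegral, ← Real.exp_add, norm_add_sq_real]
  congr 1
  ring

theorem norm_wickL2_sq (X : CenteredGaussianProcess μ T) (h : X.Integrands) :
    ‖X.wickL2 h‖ ^ 2 = Real.exp (‖h‖ ^ 2) := by
  rw [← real_inner_self_eq_norm_sq, ← sTransform_eq_inner, sTransform_wickL2,
    real_inner_self_eq_norm_sq]

end CenteredGaussianProcess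

/-! ### The $S$-transform determines the random variable. -/

/-- Two finite measures with the same, everywhere finite, moment generating function of `Z` give the
same law to `Z`. -/
theorem map_eq_of_mgf_eq {Ω : Type*} [MeasurableSpace Ω] {ν ν' : Measure Ω} [IsFiniteMeasure ν]
    [IsFiniteMeasure ν'] {Z : Ω → ℝ} (hZ : AEMeasurable Z ν) (hZ' : AEMeasurable Z ν')
    (hint : ∀ u, Integrable (fun ω => Real.exp (u * Z ω)) ν) (h : mgf Z ν = mgf Z ν') :
    ν.map Z = ν'.map Z := by
  refine Measure.ext_of_complexMGF_eq hZ hZ' ?_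
  have hν : ν = 0 ↔ ν' = 0 := by
    have h0 := congrFun h 0
    simp only [mgf, zero_mul, Real.exp_zero, integral_const, smul_eq_mul, mul_one] at h0
    rw [← Measure.measure_univ_eq_zero, ← measureReal_eq_zero_iff, h0, measureReal_eq_zero_iff,
      Measure.measure_univ_eq_zero]
  -- The strip on which the moment generating function continues analytically is all of $\mathbb C$,
  -- so equality on the real line spreads everywhere.
  have huniv : integrableExpSet Z ν = Set.univ := Set.eq_univ_of_forall hint
  have := eqOn_complexMGF_of_mgf' h hν
  rw [huniv] at this
  ext z
  exact this (by simp)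

/-- Cramér–Wold: the one-dimensional laws of all $L\circ Y$ agree, and they determine the law of
$Y$. -/
theorem measure_map_eq_of_mgf_eq {Ω ι : Type*} [MeasurableSpace Ω] [Finite ι]
    {ν ν' : Measure Ω} [IsFiniteMeasure ν] [IsFiniteMeasure ν'] {Y : Ω → ι → ℝ} (hY : Measurable Y)
    (hint : ∀ L : StrongDual ℝ (ι → ℝ), Integrable (fun ω => Real.exp (L (Y ω))) ν)
    (h : ∀ L : StrongDual ℝ (ι → ℝ), ∫ ω, Real.exp (L (Y ω)) ∂ν = ∫ ω, Real.exp (L (Y ω)) ∂ν') :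
    ν.map Y = ν'.map Y := by
  have := Fintype.ofFinite ι
  refine Measure.ext_of_charFunDual (funext fun L => ?_)
  have hLY : Measurable (L ∘ Y) := by fun_prop
  rw [charFunDual_eq_charFun_map_one, charFunDual_eq_charFun_map_one,
    Measure.map_map (by fun_prop) hY, Measure.map_map (by fun_prop) hY,
    map_eq_of_mgf_eq hLY.aemeasurable hLY.aemeasurable (fun u => hint (u • L))
      (funext fun u => h (u • L))]

theorem measure_eq_of_finite_dimensional {Ω ι : Type*} [MeasurableSpace Ω]
    {ν ν' : Measure Ω} [IsFiniteMeasure ν] [IsFiniteMeasure ν'] {Y : ι → Ω → ℝ}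
    (hY : ∀ i, Measurable (Y i))
    (h : ∀ J : Finset ι, ν.map (fun ω (j : J) => Y j ω) = ν'.map (fun ω (j : J) => Y j ω)) :
    ν.map (fun ω i => Y i ω) = ν'.map (fun ω i => Y i ω) := by
  have hm : Measurable fun ω i => Y i ω := measurable_pi_lambda _ hY
  refine IsProjectiveLimit.unique (P := fun J => ν.map (fun ω (j : J) => Y j ω)) (fun J => ?_)
    (fun J => ?_)
  · rw [Measure.map_map (by fun_prop) hm]; rfl
  · rw [Measure.map_map (by fun_prop) hm]; exact (h J).symm

namespace CenteredGaussianProcess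

variable {Ω : Type*} [MeasurableSpace Ω] {μ : Measure Ω} {T : ℝ} [IsProbabilityMeasure μ]

/-- The `S`-transform determines an element of `L²_X`. -/
theorem eq_zero_of_sTransform_eq_zero (X : CenteredGaussianProcess μ T) (ξ : X.L2X)
    (hξ : ∀ h, X.sTransform ξ h = 0) : ξ = 0 := by
  set f : Ω → ℝ := ((ξ : Lp ℝ 2 μ) : Ω → ℝ) with hf
  have hfm : Measurable f := (Lp.stronglyMeasurable _).measurable
  have hfL : MemLp f 2 μ := Lp.memLp _
  have hfi : Integrable f μ := hfL.integrable (by norm_num)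
  have hfin (g : Ω → ℝ) (hg : Integrable g μ) :
      IsFiniteMeasure (μ.withDensity fun ω => ENNReal.ofReal (g ω)) :=
    isFiniteMeasure_withDensity_ofReal hg.2
  -- The positive and negative parts of the signed measure $\xi\,dP$; the goal is that they agree on
  -- $\mathcal F^X_T$.
  let ν := μ.withDensity fun ω => ENNReal.ofReal (f ω)
  let ν' := μ.withDensity fun ω => ENNReal.ofReal (-f ω)
  have : IsFiniteMeasure ν := hfin f hfi
  have : IsFiniteMeasure ν' := hfin (fun ω => -f ω) hfi.neg
  have hint (g : Ω → ℝ) (hg : Measurable g) (G : Ω → ℝ) (hgG : Integrable (fun ω => g ω * G ω) μ) :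
      Integrable G (μ.withDensity fun ω => ENNReal.ofReal (g ω)) := by
    rw [integrable_withDensity_iff_integrable_smul' (by fun_prop) (by simp)]
    have hpos : AEStronglyMeasurable (fun ω => (ENNReal.ofReal (g ω)).toReal • G ω) μ := by
      -- Only the product $gG$ is known to be measurable, so $g^+G$ is written as its restriction to
      -- $\{g\ge 0\}$.
      have h1 : (fun ω => (ENNReal.ofReal (g ω)).toReal • G ω)
          = {ω | 0 ≤ g ω}.indicator fun ω => g ω * G ω := by
        ext ω
        by_cases h0 : 0 ≤ g ω
        · simp [h0]
        · simp [h0, ENNReal.ofReal_of_nonpos (not_le.1 h0).le]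
      rw [h1]
      exact hgG.aestronglyMeasurable.indicator (measurableSet_le measurable_const hg)
    refine hgG.mono hpos (.of_forall fun ω => ?_)
    rw [norm_smul, norm_mul, ENNReal.toReal_ofReal']
    refine mul_le_mul_of_nonneg_right ?_ (norm_nonneg _)
    rw [Real.norm_of_nonneg (le_max_right _ _)]
    exact max_le (le_abs_self _) (abs_nonneg _)
  have hdiff (G : Ω → ℝ) (hG : Integrable (fun ω => f ω * G ω) μ) :
      ∫ ω, G ω ∂ν - ∫ ω, G ω ∂ν' = ∫ ω, f ω * G ω ∂μ := by
    have hG' : Integrable (fun ω => -f ω * G ω) μ := by simpa using hG.neg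
    have i1 := (integrable_withDensity_iff_integrable_smul' (by fun_prop) (by simp)).1
      (hint f hfm G hG)
    have i2 := (integrable_withDensity_iff_integrable_smul' (by fun_prop) (by simp)).1
      (hint (fun ω => -f ω) hfm.neg G hG')
    rw [integral_withDensity_eq_integral_toReal_smul (by fun_prop) (by simp),
      integral_withDensity_eq_integral_toReal_smul (by fun_prop) (by simp), ← integral_sub i1 i2]
    refine integral_congr_ae (.of_forall fun ω => ?_)
    simp only [ENNReal.toReal_ofReal', smul_eq_mul]
    rcases le_total 0 (f ω) with h0 | h0 <;> simp [h0]
  have hvm : Measurable fun ω (t : Set.Icc (0 : ℝ) T) => X.val t ω :=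
    measurable_pi_lambda _ X.measurable_val
  have hlaw : ν.map (fun ω t => X.val t ω) = ν'.map (fun ω t => X.val t ω) := by
    refine measure_eq_of_finite_dimensional X.measurable_val fun J => ?_
    -- Up to the factor $e^{\|h\|^2/2}$, these exponential moments against $\xi$ are values of
    -- $S\xi$, hence zero.
    have hexp (L : StrongDual ℝ (J → ℝ)) :
        Integrable (fun ω => f ω * Real.exp (L fun j : J => X.val j ω)) μ ∧
          ∫ ω, f ω * Real.exp (L fun j : J => X.val j ω) ∂μ = 0 := by
      obtain ⟨h, hh⟩ := X.dual_val_eq_wienerIntegral J L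
      have hae : (fun ω => f ω * Real.exp (L fun j : J => X.val j ω)) =ᵐ[μ]
          fun ω => f ω * X.wickExp h ω * Real.exp (‖h‖ ^ 2 / 2) := by
        filter_upwards [hh] with ω hω
        rw [hω, wickExp_eq, mul_assoc, ← Real.exp_add, sub_add_cancel]
      refine ⟨((hfL.integrable_mul (X.memLp_wickExp h)).mul_const _).congr hae.symm, ?_⟩
      rw [integral_congr_ae hae, integral_mul_const]
      have : ∫ ω, f ω * X.wickExp h ω ∂μ = 0 := hξ h
      rw [this, zero_mul]
    refine measure_map_eq_of_mgf_eq (measurable_pi_lambda _ fun j => X.measurable_val j)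
      (fun L => hint f hfm _ (hexp L).1) fun L => ?_
    rw [← sub_eq_zero, hdiff _ (hexp L).1, (hexp L).2]
  -- Events of $\mathcal F^X_T$ are preimages under the path map, whose laws under the two measures
  -- coincide.
  have hset (s : Set Ω) (hs : MeasurableSet[X.filtration X.endTime] s) : ν s = ν' s := by
    have hle : X.filtration X.endTime ≤
        MeasurableSpace.comap (fun ω t => X.val t ω) inferInstance := by
      rw [filtration, Filtration.natural_eq_comap]
      rintro _ ⟨B, hB, rfl⟩
      exact ⟨_, (measurable_pi_lambda _ fun j : Set.Iic X.endTime =>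
        measurable_pi_apply (j : Set.Icc (0 : ℝ) T)) hB, rfl⟩
    obtain ⟨B, hB, rfl⟩ := hle s hs
    rw [← Measure.map_apply hvm hB, hlaw, Measure.map_apply hvm hB]
  refine Subtype.ext ((Lp.eq_zero_iff_ae_eq_zero).2 ?_)
  refine lpMeas.ae_eq_zero_of_forall_setIntegral_eq_zero (X.filtration.le _) ξ (by simp) (by simp)
    (fun s _ _ => hfi.integrableOn) fun s hs _ => ?_
  have hs' := X.filtration.le _ s hs
  have h1 := hdiff (s.indicator 1) (by
    refine (hfi.indicator hs').congr (.of_forall fun ω => ?_)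
    by_cases hω : ω ∈ s <;> simp [hω])
  rw [integral_indicator_one hs', integral_indicator_one hs', measureReal_def, measureReal_def,
    hset s hs, sub_self] at h1
  rw [← integral_indicator hs']
  refine Eq.trans (integral_congr_ae (.of_forall fun ω => ?_)) h1.symm
  by_cases hω : ω ∈ s <;> simp [hω, hf]

theorem sTransform_injective (X : CenteredGaussianProcess μ T) {ξ η : X.L2X}
    (h : ∀ g, X.sTransform ξ g = X.sTransform η g) : ξ = η := by
  rw [← sub_eq_zero]
  refine X.eq_zero_of_sTransform_eq_zero _ fun g => ?_
  rw [sTransform_eq_inner, inner_sub_right, ← sTransform_eq_inner, ← sTransform_eq_inner, h,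
    sub_self]

end CenteredGaussianProcess

/-! ### Contractive and self-adjoint idempotents. -/

/-- As $P(u+cv)=u$, contractivity gives $\|u\|\le\|u+cv\|$ for every real $c$. The resulting
quadratic in $c$ is nonnegative with zero constant term, so its discriminant $4\langle u,v\rangle^2$
must vanish. -/
theorem inner_eq_zero_of_norm_le_one {E : Type*} [NormedAddCommGroup E] [InnerProductSpace ℝ E]
    {P : E →L[ℝ] E} (hP : ‖P‖ ≤ 1) {u v : E} (hu : P u = u) (hv : P v = 0) :
    inner ℝ u v = 0 := by
  have key (c : ℝ) : 0 ≤ ‖v‖ ^ 2 * (c * c) + 2 * inner ℝ u v * c + 0 := by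
    have h1 : ‖u‖ ≤ ‖u + c • v‖ := by
      have := P.le_of_opNorm_le hP (u + c • v)
      rwa [map_add, map_smul, hu, hv, smul_zero, add_zero, one_mul] at this
    have h2 := pow_le_pow_left₀ (norm_nonneg u) h1 2
    rw [norm_add_sq_real, norm_smul, inner_smul_right, mul_pow, Real.norm_eq_abs, sq_abs] at h2
    nlinarith
  have := discrim_le_zero key
  rw [discrim] at this
  nlinarith [sq_nonneg (inner ℝ u v : ℝ)]

/-- By Cauchy–Schwarz, $\|Px\|^2=\langle x,Px\rangle\le\|x\|\,\|Px\|$. -/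
theorem norm_le_one_of_isSelfAdjoint_of_isIdempotentElem {E : Type*} [NormedAddCommGroup E]
    [InnerProductSpace ℝ E] {P : E →L[ℝ] E}
    (hs : ∀ x y, inner ℝ (P x) y = inner ℝ x (P y)) (hi : ∀ x, P (P x) = P x) : ‖P‖ ≤ 1 := by
  refine P.opNorm_le_bound zero_le_one fun x => ?_
  have h1 : ‖P x‖ * ‖P x‖ = inner ℝ x (P x) := by
    rw [← real_inner_self_eq_norm_mul_norm, hs, hi]
  have h2 := real_inner_le_norm x (P x)
  rw [← h1] at h2
  rcases (norm_nonneg (P x)).eq_or_lt with h0 | h0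
  · rw [← h0]; positivity
  · rw [one_mul]; exact le_of_mul_le_mul_right h2 h0

/-! ### Uncorrelated increments and the operators $\mathbb I_r$. -/

namespace CenteredGaussianProcess

variable {Ω : Type*} [MeasurableSpace Ω] {μ : Measure Ω} {T : ℝ}

/-- The increments of `X` after time `r` are uncorrelated with `X` before `r`. -/
def UncorrelatedIncrements (X : CenteredGaussianProcess μ T) : Prop :=
  ∀ s r t : Set.Icc (0 : ℝ) T, s ≤ r → r ≤ t → X.cov t s = X.cov r s

theorem cov_comm (X : CenteredGaussianProcess μ T) (s t : Set.Icc (0 : ℝ) T) :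
    X.cov s t = X.cov t s := by
  simp only [cov, mul_comm]

section truncation

variable (X : CenteredGaussianProcess μ T) (hX : X.HasIndefiniteWienerIntegral)

theorem truncation_truncation (r : Set.Icc (0 : ℝ) T) (h : X.Integrands) :
    X.truncation hX r (X.truncation hX r h) = X.truncation hX r h := by
  have : (X.truncation hX r).comp (X.truncation hX r) = X.truncation hX r := by
    refine X.ext_ind fun t => ?_
    rw [ContinuousLinearMap.comp_apply, truncation_ind, truncation_ind, min_assoc, min_self]
  exact congrArg (fun A => A h) this

/-- For $s\le r\le t$, $\mathbb I_r$ fixes $\mathbf 1_{(0,s]}$ and kills $\mathbf 1_{(0,t]}-\mathbf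
1_{(0,r]}$, so these are orthogonal. -/
theorem uncorrelatedIncrements_of_norm_le_one (h : ∀ r, ‖X.truncation hX r‖ ≤ 1) :
    X.UncorrelatedIncrements := by
  intro s r t hsr hrt
  have := inner_eq_zero_of_norm_le_one (h r) (u := X.ind s) (v := X.ind t - X.ind r)
    (by rw [truncation_ind, min_eq_left hsr])
    (by rw [map_sub, truncation_ind, truncation_ind, min_eq_right hrt, min_self, sub_self])
  rw [inner_sub_right, inner_ind, inner_ind, sub_eq_zero] at this
  rw [cov_comm, this, cov_comm]

variable {X}

/-- Both sides equal the variance at the least of $r,s,t$. This is self-adjointness of $\mathbb I_r$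
on indicators. -/
theorem UncorrelatedIncrements.cov_min (hc : X.UncorrelatedIncrements)
    (r s t : Set.Icc (0 : ℝ) T) : X.cov (min t r) s = X.cov t (min s r) := by
  rcases le_total t r with ht | ht <;> rcases le_total s r with hs | hs
  · rw [min_eq_left ht, min_eq_left hs]
  · rw [min_eq_left ht, min_eq_right hs, cov_comm, hc t r s ht hs, cov_comm]
  · rw [min_eq_right ht, min_eq_left hs, hc s r t hs ht]
  · rw [min_eq_right ht, min_eq_right hs, cov_comm, hc r r s le_rfl hs, hc r r t le_rfl ht]

/-- Extends `UncorrelatedIncrements.cov_min` from indicators by density, in one argument at a time.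
-/
theorem UncorrelatedIncrements.inner_truncation (hc : X.UncorrelatedIncrements)
    (r : Set.Icc (0 : ℝ) T) (g h : X.Integrands) :
    inner ℝ (X.truncation hX r g) h = inner ℝ g (X.truncation hX r h) := by
  have h1 (t : Set.Icc (0 : ℝ) T) : (innerSL ℝ (X.ind (min t r)) : X.Integrands →L[ℝ] ℝ)
      = (innerSL ℝ (X.ind t)).comp (X.truncation hX r) := by
    refine X.ext_ind fun s => ?_
    simp only [ContinuousLinearMap.comp_apply, innerSL_apply_apply, truncation_ind, inner_ind]
    exact hc.cov_min r s t
  have h2 : (innerSL ℝ h).comp (X.truncation hX r) = innerSL ℝ (X.truncation hX r h) := by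
    refine X.ext_ind fun t => ?_
    have := congrArg (fun A => A h) (h1 t)
    simp only [ContinuousLinearMap.comp_apply, innerSL_apply_apply] at this ⊢
    rw [truncation_ind, real_inner_comm, this, real_inner_comm]
  have := congrArg (fun A => A g) h2
  simp only [ContinuousLinearMap.comp_apply, innerSL_apply_apply] at this
  rw [real_inner_comm, this, real_inner_comm]

theorem UncorrelatedIncrements.adjoint_truncation (hc : X.UncorrelatedIncrements)
    (r : Set.Icc (0 : ℝ) T) :
    ContinuousLinearMap.adjoint (X.truncation hX r) = X.truncation hX r :=
  ((ContinuousLinearMap.eq_adjoint_iff _ _).2 (hc.inner_truncation hX r)).symm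

theorem UncorrelatedIncrements.norm_truncation_le_one (hc : X.UncorrelatedIncrements)
    (r : Set.Icc (0 : ℝ) T) : ‖X.truncation hX r‖ ≤ 1 :=
  norm_le_one_of_isSelfAdjoint_of_isIdempotentElem (hc.inner_truncation hX r)
    (X.truncation_truncation hX r)

variable (X)

theorem ind_eq_zero_iff (t : Set.Icc (0 : ℝ) T) : X.ind t = 0 ↔ X.val t =ᵐ[μ] 0 := by
  rw [← norm_eq_zero, ← norm_wienerIntegral, norm_eq_zero, wienerIntegral_ind,
    Lp.eq_zero_iff_ae_eq_zero]
  exact ⟨(X.memLp_val t).coeFn_toLp.symm.trans, (X.memLp_val t).coeFn_toLp.trans⟩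

/-- The nonzero vector $\mathbf 1_{(0,s]}$ is fixed by $\mathbb I_r$. -/
theorem one_le_norm_truncation {r s : Set.Icc (0 : ℝ) T} (hsr : s ≤ r) (hs : ¬ X.val s =ᵐ[μ] 0) :
    1 ≤ ‖X.truncation hX r‖ := by
  rw [← ind_eq_zero_iff, ← norm_eq_zero] at hs
  have := (X.truncation hX r).le_opNorm (X.ind s)
  rw [truncation_ind, min_eq_left hsr] at this
  have h0 : 0 < ‖X.ind s‖ := (norm_nonneg _).lt_of_ne (Ne.symm hs)
  nlinarith

theorem truncation_eq_zero {r : Set.Icc (0 : ℝ) T} (hr : ∀ s ≤ r, X.val s =ᵐ[μ] 0) :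
    X.truncation hX r = 0 := by
  refine X.ext_ind fun t => ?_
  rw [truncation_ind, zero_apply, ind_eq_zero_iff]
  exact hr _ (min_le_right _ _)

theorem wienerIntegral_truncation_mem (r : Set.Icc (0 : ℝ) T) (h : X.Integrands) :
    X.wienerIntegral (X.truncation hX r h) ∈ lpMeas ℝ ℝ (X.filtration r) 2 μ := by
  refine X.closure_induction_integrands ((lpMeas ℝ ℝ (X.filtration r) 2 μ).comap
    (X.wienerIntegral.comp (X.truncation hX r)).toLinearMap) ?_ ?_ h
  · have hc : IsClosed (lpMeas ℝ ℝ (X.filtration r) 2 μ : Set (Lp ℝ 2 μ)) :=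
      (completeSpace_coe_iff_isComplete.1
        (inferInstanceAs (CompleteSpace (lpMeas ℝ ℝ (X.filtration r) 2 μ)))).isClosed
    exact hc.preimage (X.wienerIntegral.comp (X.truncation hX r)).continuous
  · intro t
    rw [Submodule.mem_comap]
    change X.wienerIntegral (X.truncation hX r (X.ind t)) ∈ _
    rw [truncation_ind, mem_lpMeas_iff_aestronglyMeasurable]
    refine ⟨X.val (min t r), ?_, X.coeFn_wienerIntegral_ind _⟩
    exact ((Filtration.stronglyAdapted_natural
      fun t => (X.measurable_val t).stronglyMeasurable) _).mono
        (X.filtration.mono (min_le_right t r))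

theorem aestronglyMeasurable_wickExp_truncation (r : Set.Icc (0 : ℝ) T) (h : X.Integrands) :
    AEStronglyMeasurable[X.filtration r] (X.wickExp (X.truncation hX r h)) μ := by
  have := mem_lpMeas_iff_aestronglyMeasurable.1 (X.wienerIntegral_truncation_mem hX r h)
  exact Real.continuous_exp.comp_aestronglyMeasurable (this.sub aestronglyMeasurable_const)

end truncation

/-! ### Independence, the martingale property and conditional expectations. -/

variable [IsProbabilityMeasure μ] {X : CenteredGaussianProcess μ T}
  (hX : X.HasIndefiniteWienerIntegral)

/-- For $s\le r$, self-adjointness gives $\langle\mathbf 1_{(0,s]},h-\mathbb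
I_rh\rangle=\langle\mathbf 1_{(0,s]}-\mathbb I_r\mathbf 1_{(0,s]},h\rangle=0$. Joint Gaussianity
upgrades this to independence. -/
theorem UncorrelatedIncrements.indep (hc : X.UncorrelatedIncrements) (r : Set.Icc (0 : ℝ) T)
    (h : X.Integrands) :
    Indep (MeasurableSpace.comap (X.wienerIntegral (h - X.truncation hX r h)) inferInstance)
      (X.filtration r) μ := by
  set k := h - X.truncation hX r h with hk
  have hkm : Measurable (X.wienerIntegral k) := (Lp.stronglyMeasurable _).measurable
  have hG : IsGaussianProcess (Sum.elim (fun s : Set.Iic r => X.val s)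
      fun _ : Unit => (X.wienerIntegral k : Ω → ℝ)) μ := by
    refine (X.isGaussianProcess_wienerIntegral.comp_right
      (Sum.elim (fun s : Set.Iic r => X.ind s) fun _ : Unit => k)).congr ?_
    rintro (s | _)
    · exact X.coeFn_wienerIntegral_ind s
    · rfl
  have hI := hG.indepFun_of_covariance_eq_zero (fun s => (X.measurable_val s).aemeasurable)
    (fun _ => hkm.aemeasurable) (fun s _ => by
      rw [covariance_eq_sub (X.memLp_val s) (Lp.memLp _), X.centered, zero_mul, sub_zero]
      have h1 : ∫ ω, (X.val s * X.wienerIntegral k) ω ∂μ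
          = inner ℝ (X.wienerIntegral (X.ind s)) (X.wienerIntegral k) := by
        rw [L2.inner_def]
        refine integral_congr_ae ?_
        filter_upwards [X.coeFn_wienerIntegral_ind s] with ω hω
        simp [hω, mul_comm]
      rw [h1, inner_wienerIntegral, hk, inner_sub_right, ← hc.inner_truncation, truncation_ind,
        min_eq_left s.2, sub_self])
  have hJ := (hI.comp (φ := id) (ψ := fun f : Unit → ℝ => f ()) measurable_id
    (measurable_pi_apply (X := fun _ : Unit => ℝ) ())).symm
  rw [IndepFun_iff_Indep] at hJ
  rw [filtration, Filtration.natural_eq_comap]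
  exact hJ

/-- The increment $X_t-X_r$ is the Wiener integral of $\mathbf 1_{(0,t]}-\mathbb I_r\mathbf
1_{(0,t]}$, which is centered and independent of $\mathcal F^X_r$. -/
theorem UncorrelatedIncrements.martingale (hX : X.HasIndefiniteWienerIntegral)
    (hc : X.UncorrelatedIncrements) :
    Martingale X.val X.filtration μ := by
  refine ⟨Filtration.stronglyAdapted_natural _, fun r t hrt => ?_⟩
  have hind := hc.indep hX r (X.ind t)
  rw [truncation_ind, min_eq_right hrt] at hind
  set k := X.ind t - X.ind r with hk
  have hkm : Measurable (X.wienerIntegral k) := (Lp.stronglyMeasurable _).measurable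
  have h1 : X.val t =ᵐ[μ] X.val r + X.wienerIntegral k := by
    rw [hk, map_sub]
    filter_upwards [Lp.coeFn_sub (X.wienerIntegral (X.ind t)) (X.wienerIntegral (X.ind r)),
      X.coeFn_wienerIntegral_ind t, X.coeFn_wienerIntegral_ind r] with ω h1 h2 h3
    rw [Pi.add_apply, h1, Pi.sub_apply, h2, h3]
    ring
  have hint (s) : Integrable (X.val s) μ := (X.memLp_val s).integrable (by norm_num)
  have hintk : Integrable (X.wienerIntegral k) μ := (Lp.memLp _).integrable (by norm_num)
  have h2 := condExp_indep_eq hkm.comap_le (X.filtration.le r)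
    (comap_measurable (X.wienerIntegral k)).stronglyMeasurable hind
  have h3 := condExp_of_stronglyMeasurable (X.filtration.le r)
    (Filtration.stronglyAdapted_natural (fun t => (X.measurable_val t).stronglyMeasurable) r)
    (hint r)
  filter_upwards [condExp_congr_ae (m := X.filtration r) h1,
    condExp_add (hint r) hintk (X.filtration r), h2] with ω e1 e2 e3
  rw [e1, e2, Pi.add_apply, e3, integral_wienerIntegral, add_zero]
  exact congrFun h3 ω

theorem uncorrelatedIncrements_of_martingale (hM : Martingale X.val X.filtration μ) :
    X.UncorrelatedIncrements := by
  intro s r t hsr hrt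
  have hs : AEStronglyMeasurable[X.filtration r] (X.val s) μ :=
    ((hM.1 s).mono (X.filtration.mono hsr)).aestronglyMeasurable
  have hts := (X.memLp_val t).integrable_mul (X.memLp_val s)
  have h1 := condExp_mul_of_aestronglyMeasurable_right hs hts
    ((X.memLp_val t).integrable (by norm_num))
  change ∫ ω, (X.val t * X.val s) ω ∂μ = _
  rw [← integral_condExp (X.filtration.le r)]
  refine integral_congr_ae ?_
  filter_upwards [h1, hM.2 r t hrt] with ω e1 e2
  rw [e1, Pi.mul_apply, e2]

theorem integral_wickExp (h : X.Integrands) : ∫ ω, X.wickExp h ω ∂μ = 1 := by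
  simp only [wickExp_eq, Real.exp_sub]
  rw [integral_div, integral_exp_wienerIntegral, div_self (Real.exp_ne_zero _)]

/-- The conditional expectation of a Wick exponential. -/
theorem UncorrelatedIncrements.condExp_wickExp (hc : X.UncorrelatedIncrements)
    (r : Set.Icc (0 : ℝ) T) (h : X.Integrands) :
    μ[X.wickExp h | X.filtration r] =ᵐ[μ] X.wickExp (X.truncation hX r h) := by
  set p := X.truncation hX r h with hp
  set k := h - p with hk
  have hind : Indep (MeasurableSpace.comap (X.wienerIntegral k) inferInstance)
    (X.filtration r) μ := hc.indep hX r h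
  have hkm : Measurable (X.wienerIntegral k) := (Lp.stronglyMeasurable _).measurable
  have horth : inner ℝ p k = 0 := by
    rw [hk, inner_sub_right, hp, hc.inner_truncation, hc.inner_truncation, truncation_truncation,
      sub_self]
  -- Orthogonality makes the normalising constants multiply, so the exponential splits into an
  -- $\mathcal F^X_r$-measurable factor and an independent factor of mean one.
  have hfac : X.wickExp h =ᵐ[μ] X.wickExp p * X.wickExp k := by
    have hpk : h = p + k := by rw [hk]; abel
    have hn : ‖h‖ ^ 2 = ‖p‖ ^ 2 + ‖k‖ ^ 2 := by
      rw [hpk, norm_add_sq_real, horth]; ring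
    filter_upwards [Lp.coeFn_add (X.wienerIntegral p) (X.wienerIntegral k)] with ω hω
    rw [← map_add, ← hpk, Pi.add_apply] at hω
    rw [Pi.mul_apply, wickExp_eq, wickExp_eq, wickExp_eq, ← Real.exp_add, hω, hn]
    congr 1
    ring
  have h2 := condExp_indep_eq hkm.comap_le (X.filtration.le r) (f := X.wickExp k)
    (Real.continuous_exp.comp_stronglyMeasurable
      ((comap_measurable (X.wienerIntegral k)).stronglyMeasurable.sub stronglyMeasurable_const))
    hind
  have h3 := condExp_mul_of_aestronglyMeasurable_left (μ := μ)
    (X.aestronglyMeasurable_wickExp_truncation hX r h)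
    ((X.memLp_wickExp p).integrable_mul (X.memLp_wickExp k))
    ((X.memLp_wickExp k).integrable (by norm_num))
  filter_upwards [condExp_congr_ae (m := X.filtration r) hfac, h2, h3] with ω e1 e2 e3
  rw [e1, e3, Pi.mul_apply, e2, integral_wickExp, mul_one]

/-- Conditional expectation is symmetric: it moves from the Wick exponential of $h$, where it yields
that of $\mathbb I_rh=\mathbb I_r^*h$, onto $\xi$. -/
theorem UncorrelatedIncrements.exists_isQuasiCondExp (hc : X.UncorrelatedIncrements)
    (r : Set.Icc (0 : ℝ) T) (ξ : X.L2X) :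
    ∃ η : X.L2X, X.IsQuasiCondExp hX r ξ η ∧
      ((η : Lp ℝ 2 μ) : Ω → ℝ) =ᵐ[μ] μ[((ξ : Lp ℝ 2 μ) : Ω → ℝ) | X.filtration r] := by
  have hξ : MemLp ((ξ : Lp ℝ 2 μ) : Ω → ℝ) 2 μ := Lp.memLp _
  have hη : MemLp (μ[((ξ : Lp ℝ 2 μ) : Ω → ℝ) | X.filtration r]) 2 μ :=
    hξ.condExp (by norm_num)
  have hηm : AEStronglyMeasurable[X.filtration r] (μ[((ξ : Lp ℝ 2 μ) : Ω → ℝ) | X.filtration r]) μ :=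
    stronglyMeasurable_condExp.aestronglyMeasurable
  refine ⟨⟨hη.toLp _, mem_lpMeas_iff_aestronglyMeasurable.2 ?_⟩, fun h => ?_, hη.coeFn_toLp⟩
  · exact ((stronglyMeasurable_condExp.mono
      (X.filtration.mono r.2.2)).aestronglyMeasurable).congr hη.coeFn_toLp.symm
  · rw [hc.adjoint_truncation]
    have hle := X.filtration.le r
    have hi1 : Integrable (((ξ : Lp ℝ 2 μ) : Ω → ℝ) * X.wickExp (X.truncation hX r h)) μ :=
      hξ.integrable_mul (X.memLp_wickExp _)
    have hi2 : Integrable (μ[((ξ : Lp ℝ 2 μ) : Ω → ℝ) | X.filtration r] * X.wickExp h) μ :=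
      hη.integrable_mul (X.memLp_wickExp h)
    have e1 := condExp_mul_of_aestronglyMeasurable_right
      (X.aestronglyMeasurable_wickExp_truncation hX r h) hi1 (hξ.integrable (by norm_num))
    have e2 := condExp_mul_of_aestronglyMeasurable_left hηm hi2
      ((X.memLp_wickExp h).integrable (by norm_num))
    calc X.sTransform ξ (X.truncation hX r h)
        = ∫ ω, μ[((ξ : Lp ℝ 2 μ) : Ω → ℝ) * X.wickExp (X.truncation hX r h) | X.filtration r] ω ∂μ :=
          (integral_condExp hle).symm
      _ = ∫ ω, μ[μ[((ξ : Lp ℝ 2 μ) : Ω → ℝ) | X.filtration r] * X.wickExp h |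
            X.filtration r] ω ∂μ := by
          refine integral_congr_ae ?_
          filter_upwards [e1, e2, hc.condExp_wickExp hX r h] with ω h1 h2 h3
          rw [h1, h2, Pi.mul_apply, Pi.mul_apply, h3]
      _ = ∫ ω, (μ[((ξ : Lp ℝ 2 μ) : Ω → ℝ) | X.filtration r] * X.wickExp h) ω ∂μ :=
          integral_condExp hle
      _ = _ := by
          refine integral_congr_ae ?_
          filter_upwards [hη.coeFn_toLp] with ω hω
          rw [Pi.mul_apply, hω]

/-! ### Everywhere defined quasi-conditional expectations. -/

theorem IsQuasiCondExp.unique {r : Set.Icc (0 : ℝ) T} {ξ η η' : X.L2X}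
    (h : X.IsQuasiCondExp hX r ξ η) (h' : X.IsQuasiCondExp hX r ξ η') : η = η' :=
  X.sTransform_injective fun g => (h g).symm.trans (h' g)

theorem isQuasiCondExp_iff_inner {r : Set.Icc (0 : ℝ) T} {ξ η : X.L2X} :
    X.IsQuasiCondExp hX r ξ η ↔ ∀ h, inner ℝ
      (X.wickL2 (ContinuousLinearMap.adjoint (X.truncation hX r) h)) ξ
        = inner ℝ (X.wickL2 h) η := by
  simp only [IsQuasiCondExp, sTransform_eq_inner]

/-- Both $S$-transforms are $e^{\langle\mathbb I_rg,h\rangle}$, with no condition on the increments.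
-/
theorem isQuasiCondExp_wickL2 (r : Set.Icc (0 : ℝ) T) (g : X.Integrands) :
    X.IsQuasiCondExp hX r (X.wickL2 g) (X.wickL2 (X.truncation hX r g)) := fun h => by
  rw [sTransform_wickL2, sTransform_wickL2, ContinuousLinearMap.adjoint_inner_right]

/-- An everywhere defined quasi-conditional expectation is bounded, by the closed graph theorem. -/
theorem exists_continuousLinearMap_isQuasiCondExp {r : Set.Icc (0 : ℝ) T}
    (hr : X.quasiDomain hX r = Set.univ) :
    ∃ A : X.L2X →L[ℝ] X.L2X, ∀ ξ, X.IsQuasiCondExp hX r ξ (A ξ) := by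
  have hex (ξ : X.L2X) : ∃ η, X.IsQuasiCondExp hX r ξ η := by
    have : ξ ∈ X.quasiDomain hX r := hr ▸ Set.mem_univ ξ
    exact this
  choose F hF using hex
  let A : X.L2X →ₗ[ℝ] X.L2X :=
    { toFun := F
      map_add' := fun x y => (hF (x + y)).unique hX (by
        rw [isQuasiCondExp_iff_inner]
        intro h
        rw [inner_add_right, inner_add_right, (isQuasiCondExp_iff_inner hX).1 (hF x),
          (isQuasiCondExp_iff_inner hX).1 (hF y)])
      map_smul' := fun c x => (hF (c • x)).unique hX (by
        rw [isQuasiCondExp_iff_inner]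
        intro h
        exact (real_inner_smul_right _ x c).trans ((congrArg (c * ·)
          ((isQuasiCondExp_iff_inner hX).1 (hF x) h)).trans
            (real_inner_smul_right _ (F x) c).symm)) }
  -- By uniqueness the graph is cut out by the defining relation, which for each $h$ is an equality
  -- of continuous functions.
  have hgraph : (A.graph : Set (X.L2X × X.L2X)) = ⋂ h : X.Integrands, {x | inner ℝ
      (X.wickL2 (ContinuousLinearMap.adjoint (X.truncation hX r) h)) x.1
        = inner ℝ (X.wickL2 h) x.2} := by
    ext x
    simp only [SetLike.mem_coe, LinearMap.mem_graph_iff, Set.mem_iInter, Set.mem_ofPred_eq]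
    rw [← isQuasiCondExp_iff_inner]
    refine ⟨fun hx => hx ▸ hF x.1, fun hx => hx.unique hX (hF x.1)⟩
  have hclosed : IsClosed (A.graph : Set (X.L2X × X.L2X)) := by
    rw [hgraph]
    exact isClosed_iInter fun h => isClosed_eq (by fun_prop) (by fun_prop)
  exact ⟨⟨A, A.continuous_of_isClosed_graph hclosed⟩, hF⟩

/-- Boundedness on Wick exponentials reads $e^{\|\mathbb I_rg\|^2}\le\|A\|^2e^{\|g\|^2}$. Scaling
$g$ scales the exponents quadratically and leaves $\|A\|$ unchanged, so $\|\mathbb I_rg\|>\|g\|$ is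
impossible. -/
theorem norm_truncation_le_one_of_quasiDomain_eq_univ {r : Set.Icc (0 : ℝ) T}
    (hr : X.quasiDomain hX r = Set.univ) : ‖X.truncation hX r‖ ≤ 1 := by
  obtain ⟨A, hA⟩ := exists_continuousLinearMap_isQuasiCondExp hX hr
  have hbound (g : X.Integrands) :
      Real.exp (‖X.truncation hX r g‖ ^ 2) ≤ ‖A‖ ^ 2 * Real.exp (‖g‖ ^ 2) := by
    rw [← norm_wickL2_sq, ← norm_wickL2_sq, ← mul_pow,
      ← (hA (X.wickL2 g)).unique hX (isQuasiCondExp_wickL2 hX r g)]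
    exact pow_le_pow_left₀ (norm_nonneg _) (A.le_opNorm _) 2
  refine ContinuousLinearMap.opNorm_le_bound _ zero_le_one fun g => ?_
  rw [one_mul]
  by_contra! hlt
  have hd : 0 < ‖X.truncation hX r g‖ ^ 2 - ‖g‖ ^ 2 := by
    have := pow_lt_pow_left₀ hlt (norm_nonneg _) two_ne_zero
    linarith
  set d := ‖X.truncation hX r g‖ ^ 2 - ‖g‖ ^ 2 with hdd
  -- This scaling makes the difference of the exponents $\|A\|^2$, giving $e^{\|A\|^2}\le\|A\|^2$,
  -- against $e^x\ge x+1$.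
  have h1 := hbound (√(‖A‖ ^ 2 / d) • g)
  have hsq : √(‖A‖ ^ 2 / d) ^ 2 = ‖A‖ ^ 2 / d := Real.sq_sqrt (by positivity)
  rw [map_smul, norm_smul, norm_smul, mul_pow, mul_pow, Real.norm_eq_abs, sq_abs, hsq,
    ← div_le_iff₀ (Real.exp_pos _), ← Real.exp_sub, ← mul_sub, ← hdd,
    div_mul_cancel₀ _ hd.ne'] at h1
  linarith [Real.add_one_le_exp (‖A‖ ^ 2)]

end CenteredGaussianProcess

theorem theorem4p13 {Ω : Type*} [MeasurableSpace Ω] {μ : Measure Ω} [IsProbabilityMeasure μ]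
    {T : ℝ} (X : CenteredGaussianProcess μ T) (hX : X.HasIndefiniteWienerIntegral) :
    List.TFAE [
      Martingale X.val X.filtration μ,
      ∀ r : Set.Icc (0 : ℝ) T, (∃ s : Set.Icc (0 : ℝ) T, s ≤ r ∧ ¬ X.val s =ᵐ[μ] 0) →
        ‖X.truncation hX r‖ = 1,
      ∀ r : Set.Icc (0 : ℝ) T, X.quasiDomain hX r = Set.univ ∧
        ∀ ξ : X.quasiDomain hX r,
          (((X.quasiCondExp hX r ξ : X.L2X) : Lp ℝ 2 μ) : Ω → ℝ)
            =ᵐ[μ] μ[(((ξ : X.L2X) : Lp ℝ 2 μ) : Ω → ℝ) | X.filtration r],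
      ∀ r : Set.Icc (0 : ℝ) T, X.quasiDomain hX r = Set.univ] := by
  tfae_have 1 → 2 := by
    rintro hM r ⟨s, hsr, hs⟩
    exact le_antisymm ((CenteredGaussianProcess.uncorrelatedIncrements_of_martingale hM).norm_truncation_le_one hX r)
      (X.one_le_norm_truncation hX hsr hs)
  tfae_have 2 → 1 := by
    intro h
    refine (X.uncorrelatedIncrements_of_norm_le_one hX fun r => ?_).martingale hX
    by_cases hr : ∃ s : Set.Icc (0 : ℝ) T, s ≤ r ∧ ¬ X.val s =ᵐ[μ] 0
    · exact (h r hr).le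
    -- Here the norm condition says nothing about $r$, but $\mathbb I_r=0$ is a contraction anyway.
    · push Not at hr
      rw [X.truncation_eq_zero hX hr]
      exact (norm_zero (E := X.Integrands →L[ℝ] X.Integrands)).trans_le zero_le_one
  tfae_have 1 → 3 := by
    intro hM r
    have hc := CenteredGaussianProcess.uncorrelatedIncrements_of_martingale hM
    refine ⟨Set.eq_univ_of_forall fun ξ => ?_, fun ξ => ?_⟩
    · obtain ⟨η, hη, -⟩ := hc.exists_isQuasiCondExp hX r ξ
      exact ⟨η, hη⟩
    · obtain ⟨η, hη, hcond⟩ := hc.exists_isQuasiCondExp hX r ξ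
      have hq : X.IsQuasiCondExp hX r ξ (X.quasiCondExp hX r ξ) := ξ.2.choose_spec
      rwa [hq.unique hX hη]
  tfae_have 3 → 4 := fun h r => (h r).1
  tfae_have 4 → 1 := fun h =>
    (X.uncorrelatedIncrements_of_norm_le_one hX fun r =>
      CenteredGaussianProcess.norm_truncation_le_one_of_quasiDomain_eq_univ hX (h r)).martingale hX
  tfae_finish

end
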